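/- Let $V$ be a finite-dimensional vector space over an arbitrary field $\mathbb{K}$, let $S=S(V^*)$ be the symmetric algebra of its dual, and let $\mathcal{A}$ be a (central) arrangement in $V$, i.e. a finite set of linear subspaces of codimension $1$. For each $H\in\mathcal{A}$ fix a linear form $\alpha_H\in V^*$ with kernel $H$. The rank of $\mathcal{A}$ is the codimension of $\bigcap_{H\in\mathcal{A}}H$. The arrangement $\mathcal{A}$ is called reducible if there are a decomposition $V=V_1\oplus V_2$ with $V_1,V_2\neq 0$ and (possibly empty) arrangements $\mathcal{A}_1$ in $V_1$ and $\mathcal{A}_2$ in $V_2$ such that $\mathcal{A}=\{H_1\oplus V_2\mid H_1\in\mathcal{A}_1\}\cup\{V_1\oplus H_2\mid H_2\in\mathcal{A}_2\}$; otherwise it is called irreducible. A hyperplane $H_0\in\mathcal{A}$ is called generic if every subspace $X\subseteq H_0$ of codimension $2$ in $V$ that is an intersection of members of $\mathcal{A}$ is contained in exactly two members of $\mathcal{A}$. For a multiplicity $m:\mathcal{A}\to\mathbb{Z}_{>0}$, the multiarrangement $(\mathcal{A},m)$ is called free if \[D(\mathcal{A},m)=\{\theta\in\operatorname{Der}_{\mathbb{K}}(S)\mid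 \theta(\alpha_H)\in\alpha_H^{m(H)}S\text{ for all }H\in\mathcal{A}\}\] is a free $S$-module. Suppose that $\mathcal{A}$ is irreducible, has rank greater than $2$, and contains a generic hyperplane $H_0$. Then $\mathcal{A}$ is totally nonfree: for every multiplicity $m:\mathcal{A}\to\mathbb{Z}_{>0}$ the multiarrangement $(\mathcal{A},m)$ is not free. -/

import Mathlib

/-- A (central) arrangement of hyperplanes in a `K`-vector space `V`: a finite set of linear
subspaces of codimension one. -/
structure HyperplaneArrangement (K V : Type*) [Field K] [AddCommGroup V] [Module K V] where
  /-- The hyperplanes of the arrangement. -/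
  hyperplanes : Finset (Submodule K V)
  codim_eq_one : ∀ H ∈ hyperplanes, Module.finrank K (V ⧸ H) = 1

namespace HyperplaneArrangement

variable {K V : Type*} [Field K] [AddCommGroup V] [Module K V]

/-- The intersection lattice `L(A)`, the set of all intersections of members of `A`
(the empty intersection being `V`). -/
def intersectionLattice (A : HyperplaneArrangement K V) : Set (Submodule K V) :=
  {X | ∃ B : Finset (Submodule K V), B ⊆ A.hyperplanes ∧ X = ⨅ H ∈ B, H}

/-- The set `L_r(A)` of the members of `L(A)` of codimension `r`. -/
def flats (A : HyperplaneArrangement K V) (r : ℕ) : Set (Submodule K V) :=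
  {X | X ∈ A.intersectionLattice ∧ Module.finrank K (V ⧸ X) = r}

/-- The rank of `A`: the codimension of the intersection of all of its hyperplanes. -/
noncomputable def rank (A : HyperplaneArrangement K V) : ℕ :=
  Module.finrank K (V ⧸ (⨅ H ∈ A.hyperplanes, H))

open Classical in
/-- The localization `A_X`, the arrangement of those hyperplanes of `A` that contain `X`. -/
noncomputable def localization (A : HyperplaneArrangement K V) (X : Submodule K V) :
    HyperplaneArrangement K V where
  hyperplanes := A.hyperplanes.filter (fun H => X ≤ H)
  codim_eq_one := fun H hH => A.codim_eq_one H (Finset.mem_filter.mp hH).1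

/-- `H` is a generic hyperplane of `A`: it belongs to `A`, and `|A_X| = 2` for every
`X ∈ L_2(A)` with `X ⊆ H`. -/
def IsGenericHyperplane (A : HyperplaneArrangement K V) (H : Submodule K V) : Prop :=
  H ∈ A.hyperplanes ∧ ∀ X ∈ A.flats 2, X ≤ H → (A.localization X).hyperplanes.card = 2

/-- `A` is reducible: `V = V₁ ⊕ V₂` with `V₁` and `V₂` nonzero, and `A` is the product of
arrangements `A₁` in `V₁` and `A₂` in `V₂` (possibly empty), i.e. the hyperplanes of `A` are the
`H₁ ⊕ V₂` with `H₁ ∈ A₁` and the `V₁ ⊕ H₂` with `H₂ ∈ A₂`. -/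
def IsReducible (A : HyperplaneArrangement K V) : Prop :=
  ∃ V₁ V₂ : Submodule K V, IsCompl V₁ V₂ ∧ V₁ ≠ ⊥ ∧ V₂ ≠ ⊥ ∧
    ∃ (A₁ : HyperplaneArrangement K V₁) (A₂ : HyperplaneArrangement K V₂),
      ∀ H : Submodule K V, H ∈ A.hyperplanes ↔
        (∃ H₁ ∈ A₁.hyperplanes, H = H₁.map V₁.subtype ⊔ V₂) ∨
        (∃ H₂ ∈ A₂.hyperplanes, H = V₁ ⊔ H₂.map V₂.subtype)

/-- `A` is irreducible if it is not reducible. -/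
def IsIrreducible (A : HyperplaneArrangement K V) : Prop :=
  ¬ A.IsReducible

/-- A multiplicity on `A`: a function from `A` to the positive integers. -/
abbrev Multiplicity (A : HyperplaneArrangement K V) : Type _ :=
  {H : Submodule K V // H ∈ A.hyperplanes} → ℕ+

/-- The module `D(A, m)` of logarithmic derivations, a submodule of the module of `K`-linear
derivations of the symmetric algebra `S = S(V*)`: those `θ` with `θ(α_H) ∈ α_H ^ m(H) S` for every
`H ∈ A`. Since the linear form `α_H` with kernel `H` is unique up to a nonzero scalar, the
condition does not depend on its choice; it is imposed for every choice. -/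
noncomputable def logDerivations (A : HyperplaneArrangement K V) (m : A.Multiplicity) :
    Submodule (SymmetricAlgebra K (Module.Dual K V))
      (Derivation K (SymmetricAlgebra K (Module.Dual K V))
        (SymmetricAlgebra K (Module.Dual K V))) where
  carrier := {θ | ∀ (H : {H : Submodule K V // H ∈ A.hyperplanes}) (α : Module.Dual K V),
    LinearMap.ker α = H.1 →
      SymmetricAlgebra.ι K (Module.Dual K V) α ^ (m H : ℕ) ∣
        θ (SymmetricAlgebra.ι K (Module.Dual K V) α)}
  add_mem' := fun {θ η} hθ hη H α hα => by
    rw [Derivation.add_apply]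
    exact dvd_add (hθ H α hα) (hη H α hα)
  zero_mem' := fun H α _ => by
    rw [Derivation.zero_apply]
    exact dvd_zero _
  smul_mem' := fun f θ hθ H α hα => by
    rw [Derivation.smul_apply, smul_eq_mul]
    exact Dvd.dvd.mul_left (hθ H α hα) f

/-- The multiarrangement `(A, m)` is free: `D(A, m)` is a free `S`-module. -/
def IsFree (A : HyperplaneArrangement K V) (m : A.Multiplicity) : Prop :=
  Module.Free (SymmetricAlgebra K (Module.Dual K V)) (A.logDerivations m)

/-- `A` is totally nonfree: `(A, m)` is not free for any multiplicity `m`. -/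
def IsTotallyNonfree (A : HyperplaneArrangement K V) : Prop :=
  ∀ m : A.Multiplicity, ¬ A.IsFree m

end HyperplaneArrangement

/-!
The idea is that freeness of `D(A, m)` forces all linear relations among the `α_H` to come from
codimension two; a generic hyperplane `H₀` takes part in no such relation, so that `α_{H₀}` is
linearly independent of the other forms and `H₀` splits off as a factor.

In homological terms, the cokernel of `Der(S) → ⨁_H S / α_H ^ m(H)`, `θ ↦ (θ(α_H))_H`, has
projective dimension at most two if `D(A, m)` is free, hence no nonzero element with support in
codimension at least three. Because `H₀` is generic, the class of the basis vector at `H₀` has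
such support, so it vanishes. In degree zero this says that some `v ∈ V` lies in all hyperplanes
but `H₀`.

The proof makes this explicit. Let `t_H` be the product of the `α_{H'} ^ m(H')` over
`H' ≠ H₀, H`, and let `v_H ∈ H` with `α_{H₀}(v_H) = 1`. For a fixed `H₁ ≠ H₀` the elements
`a = α_{H₀} ^ m(H₀)`, `b = t_{H₁}` and `c = ∑_H t_H` annihilate the class. They form a regular
sequence, since the ideals `(α_{H₀}, α_H)` are distinct primes
(`Ideal.mem_span_pow_prod_of_mul_mem`). With `θ_b = t_{H₁} ∂_{v_{H₁}}` and
`θ_c = ∑_H t_H ∂_{v_H}`, the derivations `a θ_b`, `a θ_c` and `c θ_b - b θ_c` belong to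
`D(A, m)`. Since `c` is regular on the free module `D(A, m)` modulo `(a, b)`
(`Module.Free.exists_eq_smul_add_smul`), it follows that `a θ_b = a d₁ + b d₂` with
`d₁, d₂ ∈ D(A, m)`. Then `d₂ = a w` for a vector field `w`, and the constant part of `w` is the
desired vector `v`
(`HyperplaneArrangement.IsFree.exists_notMem_of_isGenericHyperplane`).
-/

/-! ### Linear forms in the symmetric algebra -/

namespace SymmetricAlgebra

variable {K M : Type*} [Field K] [AddCommGroup M] [Module K M]

/-- The ideal of the symmetric algebra generated by a subspace `W` of `M` is prime: it is the
kernel of the endomorphism induced by a linear projection of `M` along `W`. -/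
theorem isPrime_span_image_ι (W : Submodule K M) :
    (Ideal.span (ι K M '' (W : Set M))).IsPrime := by
  obtain ⟨U, hU⟩ := W.exists_isCompl
  let P : M →ₗ[K] M := U.projection W hU.symm
  let π : SymmetricAlgebra K M →ₐ[K] SymmetricAlgebra K M := lift (ι K M ∘ₗ P)
  have hπ : ∀ x, π (ι K M x) = ι K M (P x) := fun x => by simp [π]
  have hker : Ideal.span (ι K M '' (W : Set M)) = RingHom.ker π := by
    apply le_antisymm
    · rw [Ideal.span_le]
      rintro _ ⟨x, hx, rfl⟩
      have : P x = 0 := (Submodule.projection_apply_eq_zero_iff hU.symm).2 hx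
      simp [hπ, this]
    · intro x hx
      -- `π` is the identity modulo the ideal, since it is so on the generators.
      have key : (Ideal.Quotient.mkₐ K (Ideal.span (ι K M '' (W : Set M)))).comp π =
          Ideal.Quotient.mkₐ K _ := by
        ext y
        change Ideal.Quotient.mk _ (π (ι K M y)) = Ideal.Quotient.mk _ (ι K M y)
        rw [hπ, Ideal.Quotient.eq, ← map_sub]
        refine Ideal.subset_span ⟨_, ?_, rfl⟩
        have : P (P y - y) = 0 := by
          rw [map_sub, sub_eq_zero]
          exact congr($((U.isIdempotentElem_projection hU.symm).eq) y)
        exact (Submodule.projection_apply_eq_zero_iff hU.symm).1 this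
      have := congr($key x)
      rw [AlgHom.comp_apply, (RingHom.mem_ker).1 hx, map_zero] at this
      exact Ideal.Quotient.eq_zero_iff_mem.1 this.symm
  rw [hker]
  exact RingHom.ker_isPrime π

theorem span_image_ι_span (s : Set M) :
    Ideal.span (ι K M '' (Submodule.span K s : Set M)) = Ideal.span (ι K M '' s) := by
  apply le_antisymm
  · rw [Ideal.span_le]
    rintro _ ⟨x, hx, rfl⟩
    have h : Submodule.span K s ≤
        ((Ideal.span (ι K M '' s)).restrictScalars K).comap (ι K M) :=
      Submodule.span_le.2 fun y hy => Ideal.subset_span ⟨y, hy, rfl⟩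
    exact h hx
  · exact Ideal.span_mono (Set.image_mono Submodule.subset_span)

theorem mem_of_ι_mem_span_image {W : Submodule K M} {x : M}
    (h : ι K M x ∈ Ideal.span (ι K M '' (W : Set M))) : x ∈ W := by
  by_contra hx
  obtain ⟨f, hf, hW⟩ := W.exists_le_ker_of_notMem hx
  have hle : Ideal.span (ι K M '' (W : Set M)) ≤ RingHom.ker (lift f) := by
    rw [Ideal.span_le]
    rintro _ ⟨y, hy, rfl⟩
    simpa using hW hy
  exact hf (by simpa using hle h)

theorem isPrime_span_pair_ι (x y : M) :
    (Ideal.span {ι K M x, ι K M y}).IsPrime := by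
  have := isPrime_span_image_ι (Submodule.span K {x, y})
  rwa [span_image_ι_span, Set.image_pair] at this

theorem mem_span_pair_of_ι_mem {x y z : M} (h : ι K M z ∈ Ideal.span {ι K M x, ι K M y}) :
    z ∈ Submodule.span K {x, y} :=
  mem_of_ι_mem_span_image (by rwa [span_image_ι_span, Set.image_pair])

theorem mem_span_singleton_of_ι_dvd {x y : M} (h : ι K M x ∣ ι K M y) :
    y ∈ Submodule.span K {x} :=
  mem_of_ι_mem_span_image (by
    rwa [span_image_ι_span, Set.image_singleton, Ideal.mem_span_singleton])

theorem prime_ι {x : M} (hx : x ≠ 0) : Prime (ι K M x) := by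
  have h0 : ι K M x ≠ 0 := fun h =>
    hx (by
      have hdvd : ι K M 0 ∣ ι K M x := by rw [h, map_zero]
      simpa using mem_span_singleton_of_ι_dvd hdvd)
  rw [← Ideal.span_singleton_prime h0]
  have := isPrime_span_image_ι (Submodule.span K {x})
  rwa [span_image_ι_span, Set.image_singleton] at this

/-- The derivation `∂_v` of `S(V*)` with `∂_v(α) = α(v)` for linear forms `α`. It is read off from
the algebra homomorphism `α ↦ α + α(v) ε` into the dual numbers. -/
noncomputable def directionalDerivation {V : Type*} [AddCommGroup V] [Module K V] (v : V) :
    Derivation K (SymmetricAlgebra K (Module.Dual K V)) (SymmetricAlgebra K (Module.Dual K V)) :=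
  let S := SymmetricAlgebra K (Module.Dual K V)
  let F : S →ₐ[K] TrivSqZeroExt S S := lift
    ((TrivSqZeroExt.inlAlgHom K S S).toLinearMap ∘ₗ ι K (Module.Dual K V) +
      (TrivSqZeroExt.inrHom S S).restrictScalars K ∘ₗ Algebra.linearMap K S ∘ₗ
        Module.Dual.eval K V v)
  have hF : (TrivSqZeroExt.fstHom K S S).comp F = AlgHom.id K S := by
    refine algHom_ext (LinearMap.ext fun α => ?_)
    change (F (ι K (Module.Dual K V) α)).fst = ι K (Module.Dual K V) α
    rw [show F (ι K (Module.Dual K V) α) = _ from lift_ι_apply _ _]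
    simp
  Derivation.mk' ((TrivSqZeroExt.sndHom S S).restrictScalars K ∘ₗ F.toLinearMap) fun x y => by
    have h : ∀ z, (F z).fst = z := fun z => congr($hF z)
    simp [TrivSqZeroExt.snd_mul, h, mul_comm]

@[simp]
theorem directionalDerivation_ι {V : Type*} [AddCommGroup V] [Module K V] (v : V)
    (α : Module.Dual K V) : directionalDerivation v (ι K (Module.Dual K V) α) =
      algebraMap K (SymmetricAlgebra K (Module.Dual K V)) (α v) := by
  simp [directionalDerivation, Algebra.algebraMap_eq_smul_one]

end SymmetricAlgebra

/-! ### Regular elements modulo an ideal with two generators -/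

section Regularity

variable {R : Type*} [CommRing R]

/-- If `c` is regular modulo `(p, q)` and modulo `(p, q')`, and `q` is regular modulo `p`, then `c`
is regular modulo `(p, q q')`. -/
theorem Ideal.mem_span_pair_mul_of_mul_mem {p q q' c : R} (hpq : ∀ y, p ∣ q * y → p ∣ y)
    (hq : ∀ x, c * x ∈ span {p, q} → x ∈ span {p, q})
    (hq' : ∀ x, c * x ∈ span {p, q'} → x ∈ span {p, q'}) (x : R)
    (hx : c * x ∈ span {p, q * q'}) : x ∈ span {p, q * q'} := by
  simp only [mem_span_pair] at *
  obtain ⟨u, v, h⟩ := hx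
  obtain ⟨u₁, v₁, h₁⟩ := hq x ⟨u, v * q', by rw [← h]; ring⟩
  obtain ⟨w, hw⟩ : p ∣ c * v₁ - q' * v :=
    hpq _ ⟨u - c * u₁, by linear_combination c * h₁ - h⟩
  obtain ⟨u₂, v₂, h₂⟩ := hq' v₁ ⟨w, v, by linear_combination -hw⟩
  exact ⟨u₁ + q * u₂, v₂, by linear_combination h₁ + q * h₂⟩

/-- An element of `R` that is regular modulo `(a, b)` is regular on `D / (a, b) D` for every free
module `D`. -/
theorem Module.Free.exists_eq_smul_add_smul {D : Type*} [AddCommGroup D] [Module R D]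
    [Module.Free R D] {a b c : R} (hc : ∀ x, c * x ∈ Ideal.span {a, b} → x ∈ Ideal.span {a, b})
    {x u v : D} (h : c • x = a • u + b • v) : ∃ y z : D, x = a • y + b • z := by
  let B := Module.Free.chooseBasis R D
  have hx : ∀ i, ∃ y z, B.repr x i = a * y + b * z := fun i => by
    have : B.repr x i ∈ Ideal.span {a, b} := by
      refine hc _ (Ideal.mem_span_pair.2 ⟨B.repr u i, B.repr v i, ?_⟩)
      have := congr(B.repr $h i)
      simp only [map_add, map_smul, Finsupp.add_apply, Finsupp.smul_apply, smul_eq_mul] at this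
      rw [this]
      ring
    obtain ⟨y, z, h⟩ := Ideal.mem_span_pair.1 this
    exact ⟨y, z, by rw [← h]; ring⟩
  choose y z hyz using hx
  refine ⟨∑ i ∈ (B.repr x).support, y i • B i, ∑ i ∈ (B.repr x).support, z i • B i, ?_⟩
  conv_lhs => rw [← B.linearCombination_repr x, Finsupp.linearCombination_apply, Finsupp.sum]
  simp only [Finset.smul_sum, ← Finset.sum_add_distrib, smul_smul, ← add_smul, hyz]

variable [IsDomain R]

theorem Prime.pow_dvd_of_pow_dvd_pow_mul {p q : R} (hp : Prime p) (h : ¬ p ∣ q) (n k : ℕ) {y : R}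
    (hy : p ^ n ∣ q ^ k * y) : p ^ n ∣ y :=
  hp.pow_dvd_of_dvd_mul_left n (fun h' => h (hp.dvd_of_dvd_pow h')) hy

theorem Ideal.mem_span_pow_pow_of_mul_mem {p q c : R} (hp : Prime p) (hq : Prime q)
    (hpq : ¬ p ∣ q) (hqp : ¬ q ∣ p) (hP : (span {p, q}).IsPrime) (hc : c ∉ span {p, q})
    (n k : ℕ) : ∀ x, c * x ∈ span {p ^ n, q ^ k} → x ∈ span {p ^ n, q ^ k} := by
  have h₁ : ∀ k x, c * x ∈ span {p, q ^ k} → x ∈ span {p, q ^ k} := by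
    intro k
    induction k with
    | zero => intro x _; simp [show span {p, (1 : R)} = ⊤ from
        eq_top_of_isUnit_mem _ (subset_span (by simp)) isUnit_one]
    | succ k ih =>
      rw [pow_succ]
      refine mem_span_pair_mul_of_mul_mem (fun y hy => ?_) ih
        fun x hx => (hP.mem_or_mem hx).resolve_left hc
      simpa using hp.pow_dvd_of_pow_dvd_pow_mul hpq 1 k (by simpa using hy)
  induction n with
  | zero => intro x _; simp [show span {(1 : R), q ^ k} = ⊤ from
      eq_top_of_isUnit_mem _ (subset_span (by simp)) isUnit_one]
  | succ n ih =>
    rw [pow_succ, span_pair_comm]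
    refine mem_span_pair_mul_of_mul_mem (fun y hy => ?_) ?_ ?_
    · exact hq.pow_dvd_of_pow_dvd_pow_mul hqp k n hy
    · rwa [span_pair_comm]
    · rw [span_pair_comm]
      exact h₁ k

/-- Let `p` and the `q i` be primes such that the ideals `(p, q i)` are prime. An element outside
all of these ideals is regular modulo a power of `p` and a product of powers of the `q i`. -/
theorem Ideal.mem_span_pow_prod_of_mul_mem {I : Type*} (s : Finset I) {p c : R} {q : I → R}
    (k : I → ℕ) (hp : Prime p) (hq : ∀ i ∈ s, Prime (q i)) (hpq : ∀ i ∈ s, ¬ p ∣ q i)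
    (hqp : ∀ i ∈ s, ¬ q i ∣ p) (hP : ∀ i ∈ s, (span {p, q i}).IsPrime)
    (hc : ∀ i ∈ s, c ∉ span {p, q i}) (n : ℕ) :
    ∀ x, c * x ∈ span {p ^ n, ∏ i ∈ s, q i ^ k i} → x ∈ span {p ^ n, ∏ i ∈ s, q i ^ k i} := by
  classical
  induction s using Finset.induction_on with
  | empty => intro x _; simp [show span {p ^ n, (1 : R)} = ⊤ from
      eq_top_of_isUnit_mem _ (subset_span (by simp)) isUnit_one]
  | insert i s hi ih =>
    simp only [Finset.mem_insert, forall_eq_or_imp] at hq hpq hqp hP hc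
    rw [Finset.prod_insert hi]
    exact mem_span_pair_mul_of_mul_mem
      (fun y hy => hp.pow_dvd_of_pow_dvd_pow_mul hpq.1 n _ hy)
      (mem_span_pow_pow_of_mul_mem hp hq.1 hpq.1 hqp.1 hP.1 hc.1 n (k i))
      (ih hq.2 hpq.2 hqp.2 hP.2 hc.2)

end Regularity

/-! ### Hyperplanes and their defining forms -/

namespace HyperplaneArrangement

open SymmetricAlgebra

variable {K V : Type*} [Field K] [AddCommGroup V] [Module K V]

theorem exists_ker_eq (A : HyperplaneArrangement K V) {H : Submodule K V}
    (hH : H ∈ A.hyperplanes) : ∃ α : Module.Dual K V, LinearMap.ker α = H := by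
  have h := A.codim_eq_one H hH
  have : Module.Finite K (V ⧸ H) := Module.finite_of_finrank_eq_succ h
  let e : (V ⧸ H) ≃ₗ[K] K := LinearEquiv.ofFinrankEq _ _ (by rw [h, Module.finrank_self])
  exact ⟨e.toLinearMap ∘ₗ H.mkQ, by rw [LinearEquiv.ker_comp, Submodule.ker_mkQ]⟩

theorem isCoatom_of_mem (A : HyperplaneArrangement K V) {H : Submodule K V}
    (hH : H ∈ A.hyperplanes) : IsCoatom H := by
  rw [← isSimpleModule_iff_isCoatom, isSimpleModule_iff_finrank_eq_one]
  exact A.codim_eq_one H hH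

theorem not_le_of_ne (A : HyperplaneArrangement K V) {H H' : Submodule K V}
    (hH : H ∈ A.hyperplanes) (hH' : H' ∈ A.hyperplanes) (hne : H ≠ H') : ¬ H ≤ H' := fun h =>
  ((A.isCoatom_of_mem hH).le_iff.1 h).elim (A.isCoatom_of_mem hH').1 fun h' => hne h'.symm

/-- The defining condition of `D(A, m)` has to be checked for one linear form per hyperplane
only. -/
theorem mem_logDerivations_of_dvd {A : HyperplaneArrangement K V} {m : A.Multiplicity}
    {α : Submodule K V → Module.Dual K V} (hα : ∀ H ∈ A.hyperplanes, LinearMap.ker (α H) = H)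
    {θ : Derivation K (SymmetricAlgebra K (Module.Dual K V))
      (SymmetricAlgebra K (Module.Dual K V))}
    (h : ∀ H : {H : Submodule K V // H ∈ A.hyperplanes},
      ι K (Module.Dual K V) (α H) ^ (m H : ℕ) ∣ θ (ι K (Module.Dual K V) (α H))) :
    θ ∈ A.logDerivations m := by
  intro H β hβ
  have hαH := hα H H.2
  have hmem : β ∈ Submodule.span K (Set.range fun _ : Unit => α H) :=
    mem_span_of_iInf_ker_le_ker (by simp [hβ, hαH])
  rw [Set.range_const] at hmem
  obtain ⟨c, rfl⟩ := Submodule.mem_span_singleton.1 hmem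
  have hc : c ≠ 0 := by
    rintro rfl
    rw [zero_smul, LinearMap.ker_zero] at hβ
    exact (A.isCoatom_of_mem H.2).1 hβ.symm
  obtain ⟨z, hz⟩ := h H
  refine ⟨(c * (c ^ (m H : ℕ))⁻¹) • z, ?_⟩
  rw [map_smul, Derivation.map_smul, hz, smul_pow, smul_mul_smul_comm]
  congr 1
  field_simp

/-- If all hyperplanes but `H₀` share a line that is not contained in `H₀ ≠ ⊥`, then this line and
`H₀` decompose the arrangement. -/
theorem isReducible_of_mem {A : HyperplaneArrangement K V} {H₀ : Submodule K V}
    (hH₀ : H₀ ∈ A.hyperplanes) (hbot : H₀ ≠ ⊥) {v : V} (hv : v ∉ H₀)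
    (h : ∀ H ∈ A.hyperplanes, H ≠ H₀ → v ∈ H) : A.IsReducible := by
  classical
  have hv0 : v ≠ 0 := fun h0 => hv (h0 ▸ H₀.zero_mem)
  have hc : IsCompl H₀ (K ∙ v) :=
    Submodule.isCompl_span_singleton_of_isCoatom_of_notMem (A.isCoatom_of_mem hH₀) hv
  have hmod : ∀ H ∈ A.hyperplanes, H ≠ H₀ →
      (K ∙ v) ⊔ (H.comap H₀.subtype).map H₀.subtype = H := fun H hH hne => by
    rw [Submodule.map_comap_subtype,
      ← sup_inf_assoc_of_le _ ((Submodule.span_singleton_le_iff_mem v H).2 (h H hH hne)), sup_comm,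
      hc.sup_eq_top, top_inf_eq]
  refine ⟨K ∙ v, H₀, hc.symm, by simpa using hv0, hbot,
    ⟨{⊥}, fun H hH => ?_⟩,
    ⟨(A.hyperplanes.erase H₀).image (Submodule.comap H₀.subtype), fun H hH => ?_⟩, fun H => ?_⟩
  · rw [Finset.mem_singleton.1 hH]
    rw [(Submodule.quotEquivOfEqBot ⊥ rfl).finrank_eq, finrank_span_singleton hv0]
  · obtain ⟨H, hH', rfl⟩ := Finset.mem_image.1 hH
    obtain ⟨hne, hHA⟩ := Finset.mem_erase.1 hH'
    rw [← isSimpleModule_iff_finrank_eq_one, isSimpleModule_iff_isCoatom]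
    refine (Submodule.isCoatom_comap_or_eq_top _ (A.isCoatom_of_mem hHA)).resolve_right fun ht => ?_
    exact A.not_le_of_ne hH₀ hHA hne.symm (Submodule.comap_subtype_eq_top.1 ht)
  · simp only [Finset.mem_singleton, exists_eq_left, Finset.mem_image, Finset.mem_erase,
      Submodule.map_bot, bot_sup_eq]
    constructor
    · intro hH
      by_cases hne : H = H₀
      · exact Or.inl hne
      · exact Or.inr ⟨_, ⟨H, ⟨hne, hH⟩, rfl⟩, (hmod H hH hne).symm⟩
    · rintro (rfl | ⟨_, ⟨H', ⟨hne, hH'⟩, rfl⟩, rfl⟩)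
      · exact hH₀
      · rwa [hmod H' hH' hne]

variable [FiniteDimensional K V]

theorem finrank_quotient_inf (A : HyperplaneArrangement K V) {H H' : Submodule K V}
    (hH : H ∈ A.hyperplanes) (hH' : H' ∈ A.hyperplanes) (hne : H ≠ H') :
    Module.finrank K (V ⧸ H ⊓ H') = 2 := by
  have hsup : H ⊔ H' = ⊤ :=
    (A.isCoatom_of_mem hH).2 _ (left_lt_sup.2 (A.not_le_of_ne hH' hH hne.symm))
  have h₁ := Submodule.finrank_sup_add_finrank_inf_eq H H'
  have h₂ := H.finrank_quotient_add_finrank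
  have h₃ := H'.finrank_quotient_add_finrank
  have h₄ := (H ⊓ H').finrank_quotient_add_finrank
  rw [A.codim_eq_one _ hH] at h₂
  rw [A.codim_eq_one _ hH'] at h₃
  rw [hsup, finrank_top] at h₁
  omega

open Classical in
/-- No further hyperplane contains the intersection of a generic hyperplane with another one. -/
theorem IsGenericHyperplane.not_inf_le {A : HyperplaneArrangement K V} {H₀ H H' : Submodule K V}
    (hgen : A.IsGenericHyperplane H₀) (hH : H ∈ A.hyperplanes) (hH' : H' ∈ A.hyperplanes)
    (h₀ : H₀ ≠ H) (h₀' : H₀ ≠ H') (hne : H ≠ H') : ¬ H₀ ⊓ H ≤ H' := by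
  intro hle
  have hcard := hgen.2 (H₀ ⊓ H)
    ⟨⟨{H₀, H}, by simp [Finset.insert_subset_iff, hgen.1, hH],
      by rw [Finset.iInf_insert, Finset.iInf_singleton]⟩,
      A.finrank_quotient_inf hgen.1 hH h₀⟩ inf_le_left
  have hsub : {H₀, H, H'} ⊆ (A.localization (H₀ ⊓ H)).hyperplanes := by
    simp [Finset.insert_subset_iff, localization, hgen.1, hH, hH', hle]
  have := Finset.card_le_card hsub
  rw [hcard, Finset.card_eq_three.2 ⟨H₀, H, H', h₀, h₀', hne, rfl⟩] at this
  omega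

/-! ### Free multiplicities and generic hyperplanes -/

/-- If a multiarrangement with a generic hyperplane `H₀` is free, then the remaining hyperplanes
share a line that is not contained in `H₀`. -/
theorem IsFree.exists_notMem_of_isGenericHyperplane {A : HyperplaneArrangement K V}
    {m : A.Multiplicity} (hfree : A.IsFree m) {H₀ : Submodule K V}
    (hgen : A.IsGenericHyperplane H₀) :
    ∃ v, v ∉ H₀ ∧ ∀ H ∈ A.hyperplanes, H ≠ H₀ → v ∈ H := by
  classical
  choose! α hα using fun H => A.exists_ker_eq (H := H)
  have hmem : ∀ {H x}, H ∈ A.hyperplanes → (α H x = 0 ↔ x ∈ H) := fun {H x} hH => by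
    rw [← LinearMap.mem_ker, hα H hH]
  have hmemA : ∀ {H}, H ∈ A.hyperplanes.erase H₀ → H ∈ A.hyperplanes :=
    fun hH => Finset.mem_of_mem_erase hH
  have hneA : ∀ {H}, H ∈ A.hyperplanes.erase H₀ → H ≠ H₀ := fun hH => Finset.ne_of_mem_erase hH
  have hα₀ : ∀ H ∈ A.hyperplanes, α H ≠ 0 := fun H hH h0 => by
    have := hα H hH
    rw [h0, LinearMap.ker_zero] at this
    exact (A.isCoatom_of_mem hH).1 this.symm
  set B := A.hyperplanes.erase H₀
  -- Without further hyperplanes, any vector outside `H₀` will do.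
  obtain hBe | ⟨H₁, hH₁⟩ := B.eq_empty_or_nonempty
  · obtain ⟨v, -, hv⟩ := SetLike.exists_of_lt (A.isCoatom_of_mem hgen.1).1.lt_top
    refine ⟨v, hv, fun H hH hne => ?_⟩
    have : H ∈ B := Finset.mem_erase.2 ⟨hne, hH⟩
    simp [hBe] at this
  have hv : ∀ H ∈ B, ∃ v ∈ H, α H₀ v = 1 := fun H hH => by
    obtain ⟨x, hxH, hx⟩ := SetLike.not_le_iff_exists.1
      (A.not_le_of_ne (hmemA hH) hgen.1 (hneA hH))
    have hx0 : α H₀ x ≠ 0 := fun h => hx ((hmem hgen.1).1 h)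
    exact ⟨(α H₀ x)⁻¹ • x, H.smul_mem _ hxH, by simp [hx0]⟩
  choose! v hvH hv₀ using hv
  let k : Submodule K V → ℕ := fun H => if h : H ∈ A.hyperplanes then m ⟨H, h⟩ else 0
  have hk : ∀ H : {H : Submodule K V // H ∈ A.hyperplanes}, (m H : ℕ) = k H := fun H => by
    simp [k, H.2]
  have hk0 : ∀ H ∈ A.hyperplanes, k H ≠ 0 := fun H hH => by simp [k, hH]
  let q : Submodule K V → SymmetricAlgebra K (Module.Dual K V) := fun H =>
    ι K (Module.Dual K V) (α H)
  have hq : ∀ H ∈ A.hyperplanes, Prime (q H) := fun H hH => prime_ι (hα₀ H hH)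
  have hqdvd : ∀ H ∈ A.hyperplanes, ∀ H' ∈ A.hyperplanes, H ≠ H' → ¬ q H ∣ q H' :=
    fun H hH H' hH' hne hdvd => by
      obtain ⟨c, hc⟩ := Submodule.mem_span_singleton.1 (mem_span_singleton_of_ι_dvd hdvd)
      refine A.not_le_of_ne hH hH' hne fun x hx => (hmem hH').1 ?_
      rw [← hc, LinearMap.smul_apply, (hmem hH).2 hx, smul_zero]
  have hqmem : ∀ H ∈ B, ∀ H' ∈ B, H ≠ H' → q H' ∉ Ideal.span {q H₀, q H} :=
    fun H hH H' hH' hne hspan => by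
      obtain ⟨c, d, hcd⟩ := Submodule.mem_span_pair.1 (mem_span_pair_of_ι_mem hspan)
      refine hgen.not_inf_le (hmemA hH) (hmemA hH') (hneA hH).symm (hneA hH').symm hne
        fun x hx => (hmem (hmemA hH')).1 ?_
      rw [← hcd, LinearMap.add_apply, LinearMap.smul_apply, LinearMap.smul_apply,
        (hmem hgen.1).2 hx.1, (hmem (hmemA hH)).2 hx.2, smul_zero, smul_zero, add_zero]
  -- Each `t H` annihilates the class of the basis vector at `H₀`, as witnessed by `θ H`.
  let t := fun H : Submodule K V => ∏ H' ∈ B.erase H, q H' ^ k H'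
  let θ := fun H : Submodule K V => t H • directionalDerivation (K := K) (v H)
  have hθι : ∀ H β, θ H (ι K _ β) = t H * algebraMap K _ (β (v H)) := fun H β => by
    rw [← directionalDerivation_ι]
    rfl
  have hθ₀ : ∀ H ∈ B, θ H (q H₀) = t H := fun H hH => by
    rw [hθι, hv₀ H hH, map_one, mul_one]
  have hθ : ∀ H ∈ B, ∀ H' ∈ B, q H' ^ k H' ∣ θ H (q H') := fun H hH H' hH' => by
    by_cases hne : H' = H
    · subst hne
      rw [hθι, (hmem (hmemA hH)).2 (hvH H' hH), map_zero, mul_zero]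
      exact dvd_zero _
    · rw [hθι]
      exact Dvd.dvd.mul_right (Finset.dvd_prod_of_mem _ (Finset.mem_erase.2 ⟨hne, hH'⟩)) _
  set a := q H₀ ^ k H₀
  set b := t H₁
  set c := ∑ H ∈ B, t H with hc
  let θc := ∑ H ∈ B, θ H
  have hθc : ∀ s, θc s = ∑ H ∈ B, θ H s := fun s => by
    simp only [θc]
    rw [← Derivation.coeFnAddMonoidHom_apply, map_sum, Finset.sum_apply]
    rfl
  have hθc₀ : θc (q H₀) = c := by
    rw [hθc]
    exact Finset.sum_congr rfl hθ₀
  have hθc' : ∀ H' ∈ B, q H' ^ k H' ∣ θc (q H') := fun H' hH' => by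
    rw [hθc]
    exact Finset.dvd_sum fun H hH => hθ H hH H' hH'
  have hmemD : ∀ η : Derivation K (SymmetricAlgebra K (Module.Dual K V))
      (SymmetricAlgebra K (Module.Dual K V)), a ∣ η (q H₀) → (∀ H ∈ B, q H ^ k H ∣ η (q H)) →
      η ∈ A.logDerivations m := fun η h₀ h => by
    refine mem_logDerivations_of_dvd hα fun H => ?_
    rw [hk]
    by_cases hH : (H : Submodule K V) = H₀
    · rw [hH]
      exact h₀
    · exact h H (Finset.mem_erase.2 ⟨hH, H.2⟩)
  have hdvdD : ∀ η ∈ A.logDerivations m, ∀ H ∈ A.hyperplanes, q H ^ k H ∣ η (q H) :=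
    fun η hη H hH => by
      rw [← hk ⟨H, hH⟩]
      exact hη ⟨H, hH⟩ (α H) (hα H hH)
  -- The only obstruction of `θ H₁` and `θc` to lie in `D(A, m)` is at `H₀`; it is removed by the
  -- factor `a`, and it cancels in `c θ H₁ - b θc`.
  let x : A.logDerivations m := ⟨a • θ H₁, hmemD _ (dvd_mul_right _ _)
    fun H hH => Dvd.dvd.mul_left (hθ H₁ hH₁ H hH) _⟩
  let y : A.logDerivations m := ⟨a • θc, hmemD _ (dvd_mul_right _ _)
    fun H hH => Dvd.dvd.mul_left (hθc' H hH) _⟩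
  let d : A.logDerivations m := ⟨c • θ H₁ - b • θc, by
    refine hmemD _ ?_ fun H hH => ?_
    · change a ∣ c * θ H₁ (q H₀) - b * θc (q H₀)
      rw [hθ₀ H₁ hH₁, hθc₀, mul_comm, sub_self]
      exact dvd_zero _
    · exact dvd_sub (Dvd.dvd.mul_left (hθ H₁ hH₁ H hH) _) (Dvd.dvd.mul_left (hθc' H hH) _)⟩
  have hrel : c • x = a • d + b • y := by
    ext1
    change c • a • θ H₁ = a • (c • θ H₁ - b • θc) + b • a • θc
    rw [smul_sub, smul_comm c a, smul_comm b a, sub_add_cancel]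
  -- Genericity makes the primes `(q H₀, q H)` pairwise incomparable, whence `c` avoids them all.
  have hreg : ∀ s, c * s ∈ Ideal.span {a, b} → s ∈ Ideal.span {a, b} := by
    refine Ideal.mem_span_pow_prod_of_mul_mem (B.erase H₁) k (hq H₀ hgen.1)
      (fun H hH => hq H (hmemA (Finset.mem_of_mem_erase hH)))
      (fun H hH => ?_) (fun H hH => ?_) (fun H hH => isPrime_span_pair_ι _ _)
      (fun H hH => ?_) (k H₀) <;> replace hH := Finset.mem_of_mem_erase hH
    · exact hqdvd H₀ hgen.1 H (hmemA hH) (hneA hH).symm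
    · exact hqdvd H (hmemA hH) H₀ hgen.1 (hneA hH)
    · -- Modulo `(q H₀, q H)`, all summands of `c` but `t H` vanish.
      intro hcmem
      have hP : (Ideal.span {q H₀, q H}).IsPrime := isPrime_span_pair_ι _ _
      have hsum : ∑ H' ∈ B.erase H, t H' ∈ Ideal.span {q H₀, q H} := by
        refine Ideal.sum_mem _ fun H' hH' => ?_
        have hdvd : q H ∣ t H' := (dvd_pow_self _ (hk0 H (hmemA hH))).trans
          (Finset.dvd_prod_of_mem (fun H' => q H' ^ k H')
            (Finset.mem_erase.2 ⟨(Finset.ne_of_mem_erase hH').symm, hH⟩))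
        exact Ideal.mem_of_dvd _ hdvd (Ideal.subset_span (by simp))
      rw [hc, ← Finset.add_sum_erase _ _ hH, Ideal.add_mem_iff_left _ hsum] at hcmem
      obtain ⟨H', hH', hmem'⟩ := hP.prod_mem_iff.1 hcmem
      exact hqmem H hH H' (Finset.mem_of_mem_erase hH') (Finset.ne_of_mem_erase hH').symm
        (hP.mem_of_pow_mem _ hmem')
  have : Module.Free _ (A.logDerivations m) := hfree
  obtain ⟨d₁, d₂, hd⟩ := Module.Free.exists_eq_smul_add_smul (D := A.logDerivations m) hreg hrel
  have hd' : ∀ s, a * θ H₁ s = a * d₁.1 s + b * d₂.1 s := fun s =>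
    congr($hd |>.1 s)
  have hb₀ : ¬ q H₀ ∣ b := fun h => by
    obtain ⟨H, hH, hdvd⟩ := ((hq H₀ hgen.1).dvd_finsetProd_iff _).1 h
    replace hH := Finset.mem_of_mem_erase hH
    exact hqdvd H₀ hgen.1 H (hmemA hH) (hneA hH).symm ((hq H₀ hgen.1).dvd_of_dvd_pow hdvd)
  have ha0 : a ≠ 0 := pow_ne_zero _ (hq H₀ hgen.1).ne_zero
  -- The derivation `d₂` is `a w` for a vector field `w`.
  have hw : ∀ β : Module.Dual K V, ∃ w, d₂.1 (ι K _ β) = a * w := fun β =>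
    (hq H₀ hgen.1).pow_dvd_of_dvd_mul_left _ hb₀
      ⟨θ H₁ (ι K _ β) - d₁.1 (ι K _ β), by linear_combination -hd' (ι K _ β)⟩
  choose w hw using hw
  -- The constant part of `w`, a functional on `V*` and hence a vector of `V`.
  let W : Module.Dual K (Module.Dual K V) :=
    { toFun := fun β => algebraMapInv (w β)
      map_add' := fun β γ => by
        rw [← map_add]
        congr 1
        apply mul_left_cancel₀ ha0
        rw [mul_add, ← hw, ← hw, ← hw, map_add, map_add]
      map_smul' := fun r β => by
        rw [RingHom.id_apply, ← map_smul]
        congr 1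
        apply mul_left_cancel₀ ha0
        rw [mul_smul_comm, ← hw, ← hw, map_smul, Derivation.map_smul] }
  have hW : ∀ β, β ((Module.evalEquiv K V).symm W) = algebraMapInv (w β) := fun β =>
    Module.apply_evalEquiv_symm_apply K V β W
  have hzero : ∀ {H s}, q H ∣ s → algebraMapInv s = 0 := fun {H s} ⟨z, hz⟩ => by
    rw [hz, map_mul, algebraMapInv_ι, zero_mul]
  refine ⟨(Module.evalEquiv K V).symm W, fun hmem₀ => ?_, fun H hH hne => ?_⟩
  · -- Comparing values at `α H₀` gives `b (1 - w (α H₀)) ∈ (a)`; as `b` is coprime to `q H₀`,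
    -- the constant term of `w (α H₀)` is `1`.
    rw [← hmem hgen.1, hW] at hmem₀
    obtain ⟨z, hz⟩ := hdvdD d₁ d₁.2 H₀ hgen.1
    have h₁ : b - d₁.1 (q H₀) = b * w (α H₀) := by
      apply mul_left_cancel₀ ha0
      have h₂ := hd' (q H₀)
      rw [hθ₀ H₁ hH₁, hw (α H₀)] at h₂
      linear_combination h₂
    have hdvd : q H₀ ∣ b * (1 - w (α H₀)) :=
      (dvd_pow_self _ (hk0 H₀ hgen.1)).trans ⟨z, by linear_combination h₁ + hz⟩
    have := hzero (((hq H₀ hgen.1).dvd_or_dvd hdvd).resolve_left hb₀)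
    rw [map_sub, map_one, hmem₀, sub_zero] at this
    exact one_ne_zero this
  · -- `q H` divides `d₂ (q H) = a w (α H)` and is coprime to `a`.
    rw [← hmem hH, hW]
    have hdvd := (dvd_pow_self _ (hk0 H hH)).trans (hdvdD d₂ d₂.2 H hH)
    rw [hw (α H)] at hdvd
    refine hzero (((hq H hH).dvd_or_dvd hdvd).resolve_left fun h => ?_)
    exact hqdvd H hH H₀ hgen.1 hne ((hq H hH).dvd_of_dvd_pow h)

end HyperplaneArrangement

theorem mainTheorem5 {K V : Type*} [Field K] [AddCommGroup V] [Module K V]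
    [FiniteDimensional K V] (A : HyperplaneArrangement K V) (hirr : A.IsIrreducible)
    (hrank : 2 < A.rank) (H₀ : Submodule K V) (hgen : A.IsGenericHyperplane H₀) :
    A.IsTotallyNonfree := by
  intro m hfree
  obtain ⟨v, hv, h⟩ := hfree.exists_notMem_of_isGenericHyperplane hgen
  refine hirr (HyperplaneArrangement.isReducible_of_mem hgen.1 ?_ hv h)
  -- If `H₀ = ⊥`, then `V` is a line and the rank is one.
  rintro rfl
  have h₁ := A.codim_eq_one _ hgen.1
  have h₂ : ⨅ H ∈ A.hyperplanes, H = ⊥ := eq_bot_iff.2 (iInf₂_le _ hgen.1)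
  rw [HyperplaneArrangement.rank, h₂, h₁] at hrank
  omega
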